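/- Let $Q\in\mathbb{R}^{N\times N}$ be symmetric positive definite, $c\in\mathbb{R}^N$ and $\gamma>0$. Let $K^*$ be the maximum number of zero components of a vector $x\in\mathbb{R}^N$ with $(x-c)^TQ(x-c)\le\gamma$. For a diagonal matrix $D\succeq 0$ let $K^*(D)$ be the maximum number of zero components of a vector $x$ with $(x-c)^TD(x-c)\le\gamma$, and let $K_d=\min\{K^*(D): D \text{ diagonal},\ 0\preceq D\preceq Q\}$ be the maximum number of zero components in the (tightest) diagonal relaxation. Suppose that $Q=(I+\Delta)\Lambda(I+\Delta)^T$ with $I+\Delta$ orthogonal and $\Lambda=\mathrm{diag}(\lambda_1,\dots,\lambda_N)$, and that $\kappa\rho<1$, where $\kappa=\lambda_{\max}(Q)/\lambda_{\min}(Q)$ is the condition number of $Q$ and $\rho$ is the spectral radius of $\Delta$. Write $S_K(a)$ for the sum of the $K$ smallest elements of a sequence $a=(a_1,\dots,a_N)$, and let $$\underline{K}_{\mathrm{na}}=\max\{K\in\{0,\dots,N\} : (1+\kappa(\rho+\rho^2))\,S_K(\{\lambda_nc_n^2\})\le\gamma\},$$ $$\overline{K}_{\mathrm{na}}=\max\{K\in\{0,\dots,N\}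 : (1-\kappa\rho)\,S_K(\{\lambda_nc_n^2\})\le\gamma\},$$ $$r_{\mathrm{na}}=\frac{1+\kappa(\rho+\rho^2)}{1-\kappa\rho}.$$ Then $$\underline{K}_{\mathrm{na}}\le K^*\le K_d\le\overline{K}_{\mathrm{na}},\qquad \overline{K}_{\mathrm{na}}\le\lceil(\underline{K}_{\mathrm{na}}+1)\,r_{\mathrm{na}}\rceil-1,$$ and, if $\underline{K}_{\mathrm{na}}>0$, $$\frac{K_d}{K^*}\le\frac{\overline{K}_{\mathrm{na}}}{\underline{K}_{\mathrm{na}}}\le\frac{\lceil(\underline{K}_{\mathrm{na}}+1)\,r_{\mathrm{na}}\rceil-1}{\underline{K}_{\mathrm{na}}}.$$ -/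

import Mathlib

noncomputable section

namespace CardMin

/-- The feasible set `{x : (x - c)ᵀ Q (x - c) ≤ γ}` of the cardinality minimization problem. -/
def ellipsoid {N : ℕ} (Q : Matrix (Fin N) (Fin N) ℝ) (c : Fin N → ℝ) (γ : ℝ) :
    Set (Fin N → ℝ) :=
  {x | (x - c) ⬝ᵥ (Q.mulVec (x - c)) ≤ γ}

/-- The number of zero-valued components of `x`. -/
def numZeros {N : ℕ} (x : Fin N → ℝ) : ℕ :=
  (Finset.univ.filter fun n => x n = 0).card

/-- `K*`: the maximum number of zero-valued components of a feasible vector. (The set is bounded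
by `N`, and it contains `numZeros c` as soon as `0 ≤ γ`, so the supremum is a maximum.) -/
def maxZeros {N : ℕ} (Q : Matrix (Fin N) (Fin N) ℝ) (c : Fin N → ℝ) (γ : ℝ) : ℕ :=
  sSup (numZeros '' ellipsoid Q c γ)

/-- `K_d`: the maximum number of zero-valued components in the (tightest) diagonal relaxation:
among all diagonal `D` with `0 ⪯ D ⪯ Q`, the relaxation with `D` in place of `Q` whose minimum
cardinality is largest, that is, whose maximum number of zeros is smallest. -/
def diagRelaxMaxZeros {N : ℕ} (Q : Matrix (Fin N) (Fin N) ℝ) (c : Fin N → ℝ) (γ : ℝ) : ℕ :=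
  sInf {K : ℕ | ∃ d : Fin N → ℝ, (Matrix.diagonal d).PosSemidef ∧
    (Q - Matrix.diagonal d).PosSemidef ∧ K = maxZeros (Matrix.diagonal d) c γ}

/-- `S_K(a)`: the sum of the `K` smallest elements of the sequence `a` (for `K ≤ N`);
`Tuple.sort a` is the permutation that puts `a` in non-decreasing order. -/
def sumSmallest {N : ℕ} (K : ℕ) (a : Fin N → ℝ) : ℝ :=
  ∑ i : Fin N with i.val < K, a (Tuple.sort a i)

/-- `κ(Q) = λ_max(Q) / λ_min(Q)`. -/
def condNumber {N : ℕ} (Q : Matrix (Fin N) (Fin N) ℝ) : ℝ :=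
  sSup (spectrum ℝ Q) / sInf (spectrum ℝ Q)

/-- `ρ(Δ)`: the spectral radius of a real matrix, i.e. the largest modulus of its complex
eigenvalues. -/
def specRadius {N : ℕ} (Δ : Matrix (Fin N) (Fin N) ℝ) : ℝ :=
  (spectralRadius ℂ (Δ.map (algebraMap ℝ ℂ))).toReal

/-- The factor `1 + κ(Q) (ρ(Δ) + ρ(Δ)²)`. -/
def upperFactor {N : ℕ} (Q Δ : Matrix (Fin N) (Fin N) ℝ) : ℝ :=
  1 + condNumber Q * (specRadius Δ + specRadius Δ ^ 2)

/-- The factor `1 - κ(Q) ρ(Δ)`. -/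
def lowerFactor {N : ℕ} (Q Δ : Matrix (Fin N) (Fin N) ℝ) : ℝ :=
  1 - condNumber Q * specRadius Δ

/-- `max {K ∈ {0, …, N} : f · S_K(a) ≤ γ}`. (It is a maximum: the set is finite, and contains `0`
as soon as `0 ≤ γ`.) -/
def maxCount {N : ℕ} (f : ℝ) (a : Fin N → ℝ) (γ : ℝ) : ℕ :=
  sSup {K : ℕ | K ≤ N ∧ f * sumSmallest K a ≤ γ}

/-- The lower bound `K̲_na`, with `lam n = λ_n(Q)`. -/
def lowerNA {N : ℕ} (Q Δ : Matrix (Fin N) (Fin N) ℝ) (lam c : Fin N → ℝ) (γ : ℝ) : ℕ :=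
  maxCount (upperFactor Q Δ) (fun n => lam n * c n ^ 2) γ

/-- The upper bound `K̄_na`, with `lam n = λ_n(Q)`. -/
def upperNA {N : ℕ} (Q Δ : Matrix (Fin N) (Fin N) ℝ) (lam c : Fin N → ℝ) (γ : ℝ) : ℕ :=
  maxCount (lowerFactor Q Δ) (fun n => lam n * c n ^ 2) γ

/-- `r_na`. -/
def ratioNA {N : ℕ} (Q Δ : Matrix (Fin N) (Fin N) ℝ) : ℝ :=
  upperFactor Q Δ / lowerFactor Q Δ

end CardMin

end

/-!
The theorem rests on one comparison of quadratic forms. Put `V = 1 + Δ` and `Λ = diagonal lam`, so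
that `Q = V Λ Vᵀ`. For a vector `z` let `w = Vᵀ z`; then `‖w‖ = ‖z‖`, and since the norms agree,
`λ_max / 2` may be subtracted from every eigenvalue:
`zᵀ Q z - zᵀ Λ z = ∑ (λ_n - λ_max / 2) (w_n - z_n) (w_n + z_n)`. The first factor is at most
`λ_max / 2` in modulus, and the Cauchy–Schwarz inequality bounds the right-hand side by
`(λ_max / 2) ‖w - z‖ ‖w + z‖ ≤ λ_max ‖Δᵀ z‖ ‖z‖`. As `1 + Δ` is orthogonal, `Δ` is normal, so its
operator norm is its spectral radius `ρ`, and `‖z‖² ≤ zᵀ Λ z / λ_min`. Altogether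
`|zᵀ Q z - zᵀ Λ z| ≤ κ ρ zᵀ Λ z` (`abs_quadForm_sub_le`).

Consequently `(1 - κρ) Λ` is an admissible diagonal matrix in the relaxation, and `(1 + κρ) Λ`,
hence also `(1 + κ(ρ + ρ²)) Λ`, dominates `Q`. For a nonnegative diagonal form, having zeros on an
index set `Z` costs at least `∑_{n ∈ Z} d_n c_n²`, which is at least `S_{|Z|}`, with equality for a
suitable `Z`; this gives the chain of inequalities between the four counts. The bound on the ratio
uses that the average `S_K / K` of the `K` smallest elements is nondecreasing in `K`
(`mul_sumSmallest_le`).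
-/

namespace CardMin

open Matrix

/-! ### Sums of the smallest elements of a sequence -/

section SumSmallest

variable {N : ℕ}

lemma card_filter_val_lt {K : ℕ} (hK : K ≤ N) :
    (Finset.univ.filter fun i : Fin N => i.val < K).card = K := by
  rw [Fin.card_filter_val_lt, min_eq_right hK]

/-- A threshold separating the `K` smallest elements from the others. -/
lemma exists_threshold (a : Fin N → ℝ) {K : ℕ} (hK : K ≤ N) (hpos : 0 < K) :
    ∃ t, (∀ i : Fin N, i.val < K → a (Tuple.sort a i) ≤ t) ∧
      ∀ i : Fin N, K ≤ i.val → t ≤ a (Tuple.sort a i) := by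
  have hmono := Tuple.monotone_sort a
  refine ⟨a (Tuple.sort a ⟨K - 1, by omega⟩), fun i hi => hmono ?_, fun i hi => hmono ?_⟩ <;>
    · rw [Fin.le_def]
      dsimp only
      omega

lemma exists_sum_eq_sumSmallest (a : Fin N → ℝ) {K : ℕ} (hK : K ≤ N) :
    ∃ Z : Finset (Fin N), Z.card = K ∧ ∑ i ∈ Z, a i = sumSmallest K a := by
  refine ⟨(Finset.univ.filter fun i : Fin N => i.val < K).map (Tuple.sort a).toEmbedding, ?_, ?_⟩
  · rw [Finset.card_map, card_filter_val_lt hK]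
  · rw [Finset.sum_map]
    rfl

lemma sumSmallest_card_le_sum (a : Fin N → ℝ) (Z : Finset (Fin N)) :
    sumSmallest Z.card a ≤ ∑ i ∈ Z, a i := by
  have hZN : Z.card ≤ N := by simpa using Finset.card_le_univ Z
  rcases Nat.eq_zero_or_pos Z.card with h0 | hpos
  · simp [sumSmallest, Finset.card_eq_zero.mp h0]
  obtain ⟨t, hlow, hhigh⟩ := exists_threshold a hZN hpos
  -- After subtracting the threshold, the `K` smallest entries are exactly the negative parts.
  have hneg : ∑ i : Fin N with i.val < Z.card, (a (Tuple.sort a i) - t) =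
      ∑ i : Fin N, min (a i - t) 0 := by
    rw [← Equiv.sum_comp (Tuple.sort a) (fun i => min (a i - t) 0), Finset.sum_filter]
    refine Finset.sum_congr rfl fun i _ => ?_
    split_ifs with hi
    · rw [min_eq_left (by linarith [hlow i hi])]
    · rw [min_eq_right (by linarith [hhigh i (not_lt.mp hi)])]
  have hle : ∑ i : Fin N, min (a i - t) 0 ≤ ∑ i ∈ Z, (a i - t) :=
    calc ∑ i : Fin N, min (a i - t) 0 ≤ ∑ i ∈ Z, min (a i - t) 0 := by
          rw [← Finset.sum_add_sum_compl Z]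
          have : ∑ i ∈ Zᶜ, min (a i - t) 0 ≤ 0 :=
            Finset.sum_nonpos fun i _ => min_le_right _ _
          linarith
      _ ≤ _ := Finset.sum_le_sum fun i _ => min_le_left _ _
  rw [← hneg, Finset.sum_sub_distrib, Finset.sum_sub_distrib, Finset.sum_const, Finset.sum_const,
    card_filter_val_lt hZN] at hle
  unfold sumSmallest
  linarith

/-- The average of the `K` smallest elements is nondecreasing in `K`. -/
lemma mul_sumSmallest_le (a : Fin N → ℝ) {K M : ℕ} (hKM : K ≤ M) (hM : M ≤ N) :
    (M : ℝ) * sumSmallest K a ≤ K * sumSmallest M a := by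
  rcases Nat.eq_zero_or_pos K with rfl | hpos
  · simp [sumSmallest]
  obtain ⟨t, hlow, hhigh⟩ := exists_threshold a (hKM.trans hM) hpos
  set A := Finset.univ.filter fun i : Fin N => i.val < K with hA
  set B := Finset.univ.filter fun i : Fin N => i.val < M with hB
  have hAB : A ⊆ B := fun i hi => by
    simp only [hA, hB, Finset.mem_filter, Finset.mem_univ, true_and] at hi ⊢
    omega
  have hcardA : A.card = K := card_filter_val_lt (hKM.trans hM)
  have hcard : ((B \ A).card : ℝ) = M - K := by
    rw [Finset.card_sdiff_of_subset hAB, hcardA, hB, card_filter_val_lt hM, Nat.cast_sub hKM]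
  have hsplit : sumSmallest M a = ∑ i ∈ B \ A, a (Tuple.sort a i) + sumSmallest K a :=
    (Finset.sum_sdiff hAB).symm
  have hK' : sumSmallest K a ≤ K * t := by
    have h := Finset.sum_le_card_nsmul A (fun i => a (Tuple.sort a i)) t fun i hi =>
      hlow i (Finset.mem_filter.mp hi).2
    rwa [hcardA, nsmul_eq_mul] at h
  have hrest : (M - K : ℝ) * t ≤ ∑ i ∈ B \ A, a (Tuple.sort a i) := by
    have h := Finset.card_nsmul_le_sum (B \ A) (fun i => a (Tuple.sort a i)) t fun i hi => by
      refine hhigh i (not_lt.mp fun hlt => (Finset.mem_sdiff.mp hi).2 ?_)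
      exact Finset.mem_filter.mpr ⟨Finset.mem_univ _, hlt⟩
    rwa [nsmul_eq_mul, hcard] at h
  have hMK : (0 : ℝ) ≤ M - K := sub_nonneg.mpr (Nat.cast_le.mpr hKM)
  have h1 := mul_le_mul_of_nonneg_left hK' hMK
  have h2 := mul_le_mul_of_nonneg_left hrest (Nat.cast_nonneg (α := ℝ) K)
  rw [hsplit]
  linarith

/-! ### The maximal counts -/

lemma bddAbove_count (f : ℝ) (a : Fin N → ℝ) (γ : ℝ) :
    BddAbove {K : ℕ | K ≤ N ∧ f * sumSmallest K a ≤ γ} :=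
  ⟨N, fun _ h => h.1⟩

lemma maxCount_mem (f : ℝ) (a : Fin N → ℝ) {γ : ℝ} (hγ : 0 ≤ γ) :
    maxCount f a γ ≤ N ∧ f * sumSmallest (maxCount f a γ) a ≤ γ :=
  Nat.sSup_mem (s := {K : ℕ | K ≤ N ∧ f * sumSmallest K a ≤ γ})
    ⟨0, Nat.zero_le _, by simpa [sumSmallest] using hγ⟩ (bddAbove_count f a γ)

lemma le_maxCount {f : ℝ} {a : Fin N → ℝ} {γ : ℝ} {K : ℕ} (hK : K ≤ N)
    (h : f * sumSmallest K a ≤ γ) : K ≤ maxCount f a γ :=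
  le_csSup (bddAbove_count f a γ) ⟨hK, h⟩

/-- Tightening the factor from `g` to `f` lowers the maximal count by a bounded ratio: if
`M ≥ (K + 1) f / g`, where `K` and `M` are the counts for `f` and `g`, then comparing the averages
`S_{K+1} / (K + 1) ≤ S_M / M` turns `g S_M ≤ γ` into `f S_{K+1} ≤ γ`, against maximality of `K`. -/
lemma maxCount_lt_mul_div {f g : ℝ} (hg : 0 < g) (hgf : g ≤ f) (a : Fin N → ℝ) {γ : ℝ}
    (hγ : 0 ≤ γ) : (maxCount g a γ : ℝ) < (maxCount f a γ + 1) * (f / g) := by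
  obtain ⟨hMN, hM⟩ := maxCount_mem g a hγ
  obtain ⟨hKN, -⟩ := maxCount_mem f a hγ
  set M := maxCount g a γ
  have hr : 1 ≤ f / g := (one_le_div hg).mpr hgf
  rcases lt_or_ge M (maxCount f a γ + 1) with hlt | hge
  · have h1 : (M : ℝ) < maxCount f a γ + 1 := by exact_mod_cast hlt
    have h2 := le_mul_of_one_le_right (by positivity : (0 : ℝ) ≤ maxCount f a γ + 1) hr
    linarith
  -- Otherwise one more than the maximal count for `f` is still at most `N`, hence infeasible.
  have hinf : γ < f * sumSmallest (maxCount f a γ + 1) a := by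
    by_contra! h
    exact absurd (le_maxCount (hge.trans hMN) h) (by omega)
  have havg := mul_sumSmallest_le a hge hMN
  push_cast at havg
  set K : ℝ := (maxCount f a γ : ℝ)
  have hK : 0 ≤ K := Nat.cast_nonneg _
  by_contra! hcon
  rw [mul_div_assoc', div_le_iff₀ hg] at hcon
  set S := sumSmallest (maxCount f a γ + 1) a
  have hS : 0 < S := by
    have : 0 < f := hg.trans_le hgf
    exact pos_of_mul_pos_right (hγ.trans_lt hinf) this.le
  have h1 : (K + 1) * (f * S) ≤ (K + 1) * γ :=
    calc (K + 1) * (f * S) = (K + 1) * f * S := by ring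
      _ ≤ M * g * S := mul_le_mul_of_nonneg_right hcon hS.le
      _ = g * (M * S) := by ring
      _ ≤ g * ((K + 1) * sumSmallest M a) := mul_le_mul_of_nonneg_left havg hg.le
      _ = (K + 1) * (g * sumSmallest M a) := by ring
      _ ≤ (K + 1) * γ := mul_le_mul_of_nonneg_left hM (by linarith)
  exact absurd (le_of_mul_le_mul_left h1 (by linarith)) (not_le.mpr hinf)

lemma numZeros_le (x : Fin N → ℝ) : numZeros x ≤ N :=
  (Finset.card_le_univ _).trans_eq (Fintype.card_fin N)

lemma bddAbove_numZeros (s : Set (Fin N → ℝ)) : BddAbove (numZeros '' s) := by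
  refine ⟨N, ?_⟩
  rintro _ ⟨x, -, rfl⟩
  exact numZeros_le x

lemma numZeros_le_maxZeros {Q : Matrix (Fin N) (Fin N) ℝ} {c x : Fin N → ℝ} {γ : ℝ}
    (hx : x ∈ ellipsoid Q c γ) : numZeros x ≤ maxZeros Q c γ :=
  le_csSup (bddAbove_numZeros _) ⟨x, hx, rfl⟩

lemma maxZeros_image_nonempty (Q : Matrix (Fin N) (Fin N) ℝ) (c : Fin N → ℝ) {γ : ℝ}
    (hγ : 0 ≤ γ) : (numZeros '' ellipsoid Q c γ).Nonempty :=
  ⟨_, c, by simpa [ellipsoid] using hγ, rfl⟩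

/-- Relaxing the quadratic form can only increase the maximum number of zeros. -/
lemma maxZeros_le_of_posSemidef_sub {Q D : Matrix (Fin N) (Fin N) ℝ} (h : (Q - D).PosSemidef)
    (c : Fin N → ℝ) {γ : ℝ} (hγ : 0 ≤ γ) : maxZeros Q c γ ≤ maxZeros D c γ := by
  refine csSup_le (maxZeros_image_nonempty Q c hγ) ?_
  rintro _ ⟨x, hx, rfl⟩
  refine numZeros_le_maxZeros ?_
  have h0 := h.dotProduct_mulVec_nonneg (x - c)
  rw [star_trivial, sub_mulVec, dotProduct_sub] at h0
  exact (sub_nonneg.mp h0).trans hx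

lemma diagRelaxMaxZeros_le {Q : Matrix (Fin N) (Fin N) ℝ} {d : Fin N → ℝ}
    (hd : (diagonal d).PosSemidef) (hQd : (Q - diagonal d).PosSemidef) (c : Fin N → ℝ) (γ : ℝ) :
    diagRelaxMaxZeros Q c γ ≤ maxZeros (diagonal d) c γ :=
  Nat.sInf_le ⟨d, hd, hQd, rfl⟩

lemma maxZeros_le_diagRelaxMaxZeros {Q : Matrix (Fin N) (Fin N) ℝ} (hQ : Q.PosSemidef)
    (c : Fin N → ℝ) {γ : ℝ} (hγ : 0 ≤ γ) : maxZeros Q c γ ≤ diagRelaxMaxZeros Q c γ := by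
  refine le_csInf ?_ ?_
  -- The zero matrix is always an admissible diagonal matrix.
  · exact ⟨_, 0, posSemidef_diagonal_iff.mpr fun _ => le_rfl, by simpa using hQ, rfl⟩
  · rintro _ ⟨d, -, hd, rfl⟩
    exact maxZeros_le_of_posSemidef_sub hd c hγ

lemma dotProduct_diagonal_mulVec (lam z : Fin N → ℝ) :
    z ⬝ᵥ (diagonal lam).mulVec z = ∑ i, lam i * z i ^ 2 := by
  simp only [dotProduct, mulVec_diagonal]
  exact Finset.sum_congr rfl fun i _ => by ring

/-- Zeros on an index set `Z` cost at least `∑ n ∈ Z, d n * c n ^ 2` in a diagonal form. -/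
lemma maxZeros_diagonal_le {f γ : ℝ} {lam : Fin N → ℝ} (hf : 0 ≤ f) (hlam : ∀ i, 0 ≤ lam i)
    (c : Fin N → ℝ) (hγ : 0 ≤ γ) :
    maxZeros (diagonal fun i => f * lam i) c γ ≤ maxCount f (fun n => lam n * c n ^ 2) γ := by
  refine csSup_le (maxZeros_image_nonempty _ c hγ) ?_
  rintro _ ⟨x, hx, rfl⟩
  refine le_maxCount (numZeros_le x) ?_
  rw [ellipsoid, Set.mem_ofPred_eq, dotProduct_diagonal_mulVec] at hx
  refine le_trans ?_ hx
  calc f * sumSmallest (numZeros x) (fun n => lam n * c n ^ 2)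
      ≤ f * ∑ n with x n = 0, lam n * c n ^ 2 :=
        mul_le_mul_of_nonneg_left (sumSmallest_card_le_sum _ _) hf
    _ = ∑ n with x n = 0, f * lam n * (x - c) n ^ 2 := by
        rw [Finset.mul_sum]
        refine Finset.sum_congr rfl fun n hn => ?_
        simp only [Pi.sub_apply, (Finset.mem_filter.mp hn).2]
        ring
    _ ≤ _ := Finset.sum_le_univ_sum_of_nonneg fun n =>
        mul_nonneg (mul_nonneg hf (hlam n)) (sq_nonneg _)

/-- If `f` times a diagonal form dominates `Q`, then setting the cheapest components of `c` to
zero stays feasible for `Q`. -/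
lemma maxCount_le_maxZeros {Q : Matrix (Fin N) (Fin N) ℝ} {f γ : ℝ} {lam : Fin N → ℝ}
    (hQ : ∀ z, z ⬝ᵥ Q.mulVec z ≤ f * ∑ i, lam i * z i ^ 2) (c : Fin N → ℝ) (hγ : 0 ≤ γ) :
    maxCount f (fun n => lam n * c n ^ 2) γ ≤ maxZeros Q c γ := by
  obtain ⟨hKN, hK⟩ := maxCount_mem f (fun n => lam n * c n ^ 2) hγ
  obtain ⟨Z, hZ, hsum⟩ := exists_sum_eq_sumSmallest (fun n => lam n * c n ^ 2) hKN
  rw [← hsum] at hK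
  have hx : (fun n => if n ∈ Z then 0 else c n) ∈ ellipsoid Q c γ := by
    refine (hQ _).trans (le_of_eq_of_le ?_ hK)
    congr 1
    rw [← Finset.sum_add_sum_compl Z, Finset.sum_eq_zero (s := Zᶜ), add_zero]
    · refine Finset.sum_congr rfl fun n hn => ?_
      simp [hn]
    · intro n hn
      simp [Finset.mem_compl.mp hn]
  refine le_trans ?_ (numZeros_le_maxZeros hx)
  rw [← hZ]
  exact Finset.card_le_card fun n hn => by simp [hn]

end SumSmallest

/-! ### Comparison of the two quadratic forms -/

section QuadForm

variable {N : ℕ} {Q Δ : Matrix (Fin N) (Fin N) ℝ} {lam : Fin N → ℝ}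

/-- A matrix that differs from an orthogonal one by the identity commutes with its transpose. -/
lemma mul_transpose_comm_of_one_add_mem (hV : 1 + Δ ∈ orthogonalGroup (Fin N) ℝ) :
    Δᵀ * Δ = Δ * Δᵀ := by
  have h1 := (mem_orthogonalGroup_iff _ _).mp hV
  have h2 := (mem_orthogonalGroup_iff' _ _).mp hV
  rw [transpose_add, transpose_one] at h1 h2
  have h3 : Δᵀ * Δ - Δ * Δᵀ = (1 + Δᵀ) * (1 + Δ) - (1 + Δ) * (1 + Δᵀ) := by noncomm_ring
  rw [h1, h2, sub_self] at h3
  exact sub_eq_zero.mp h3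

open scoped Matrix.Norms.L2Operator in
/-- The complexification of a real normal matrix is a normal element of a C⋆-algebra, so its norm is
its spectral radius. -/
lemma l2_opNorm_map_eq_specRadius (hΔ : Δᵀ * Δ = Δ * Δᵀ) :
    ‖Δ.map (algebraMap ℝ ℂ)‖ = specRadius Δ := by
  have hstar : (Δ.map (algebraMap ℝ ℂ))ᴴ = Δᵀ.map (algebraMap ℝ ℂ) := by
    ext i j
    simp
  have : IsStarNormal (Δ.map (algebraMap ℝ ℂ)) := ⟨by
    rw [commute_iff_eq, star_eq_conjTranspose, hstar, ← Matrix.map_mul, ← Matrix.map_mul, hΔ]⟩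
  rw [specRadius, IsStarNormal.spectralRadius_eq_nnnorm]
  rfl

open scoped Matrix.Norms.L2Operator in
lemma sum_transpose_mulVec_sq_le (hΔ : Δᵀ * Δ = Δ * Δᵀ) (z : Fin N → ℝ) :
    ∑ i, (Δᵀ *ᵥ z) i ^ 2 ≤ specRadius Δ ^ 2 * ∑ i, z i ^ 2 := by
  have h := l2_opNorm_mulVec (Δ.map (algebraMap ℝ ℂ))ᴴ (WithLp.toLp 2 fun i => (z i : ℂ))
  rw [l2_opNorm_conjTranspose, l2_opNorm_map_eq_specRadius hΔ] at h
  have h2 := pow_le_pow_left₀ (norm_nonneg _) h 2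
  rw [mul_pow, EuclideanSpace.norm_sq_eq, EuclideanSpace.norm_sq_eq] at h2
  have hentry : ∀ i, ((Δ.map Complex.ofReal)ᴴ *ᵥ fun i => (z i : ℂ)) i =
      (((Δᵀ *ᵥ z) i : ℝ) : ℂ) := fun i => by
    simp [mulVec, dotProduct]
  simpa [hentry, Complex.norm_real, sq_abs] using h2

lemma specRadius_nonneg (Δ : Matrix (Fin N) (Fin N) ℝ) : 0 ≤ specRadius Δ :=
  ENNReal.toReal_nonneg

lemma quadForm_eq_sum (hdiag : Q = (1 + Δ) * diagonal lam * (1 + Δ)ᵀ) (z : Fin N → ℝ) :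
    z ⬝ᵥ Q *ᵥ z = ∑ i, lam i * ((1 + Δ)ᵀ *ᵥ z) i ^ 2 := by
  rw [← dotProduct_diagonal_mulVec, hdiag, ← mulVec_mulVec, ← mulVec_mulVec, dotProduct_mulVec,
    ← mulVec_transpose]

lemma sum_transpose_mulVec_sq_eq {V : Matrix (Fin N) (Fin N) ℝ}
    (hV : V ∈ orthogonalGroup (Fin N) ℝ) (z : Fin N → ℝ) :
    ∑ i, (Vᵀ *ᵥ z) i ^ 2 = ∑ i, z i ^ 2 := by
  have h1 := (mem_orthogonalGroup_iff _ _).mp hV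
  have h2 : (Vᵀ *ᵥ z) ⬝ᵥ (Vᵀ *ᵥ z) = z ⬝ᵥ z := by
    rw [mulVec_transpose V z, ← dotProduct_mulVec, ← mulVec_transpose, mulVec_mulVec, h1,
      one_mulVec]
  simpa only [dotProduct, ← sq] using h2

lemma eigenvalue_pos (hQ : Q.PosDef) (hV : 1 + Δ ∈ orthogonalGroup (Fin N) ℝ)
    (hdiag : Q = (1 + Δ) * diagonal lam * (1 + Δ)ᵀ) (i : Fin N) : 0 < lam i := by
  have hstar : star (1 + Δ) = (1 + Δ)ᵀ := by
    rw [star_eq_conjTranspose, conjTranspose_eq_transpose_of_trivial]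
  have hunit : IsUnit (1 + Δ) :=
    IsUnit.of_mul_eq_one _ ((mem_orthogonalGroup_iff _ _).mp hV)
  rw [hdiag, ← hstar, IsUnit.posDef_star_right_conjugate_iff hunit, posDef_diagonal_iff] at hQ
  exact hQ i

lemma spectrum_eq_range (hV : 1 + Δ ∈ orthogonalGroup (Fin N) ℝ)
    (hdiag : Q = (1 + Δ) * diagonal lam * (1 + Δ)ᵀ) : spectrum ℝ Q = Set.range lam := by
  have hstar : star (1 + Δ) = (1 + Δ)ᵀ := by
    rw [star_eq_conjTranspose, conjTranspose_eq_transpose_of_trivial]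
  rw [hdiag, ← hstar, ← spectrum_diagonal lam]
  exact Unitary.spectrum_star_right_conjugate (R := ℝ) (a := diagonal lam) (U := ⟨1 + Δ, hV⟩)

lemma condNumber_nonneg (hQ : Q.PosDef) (hV : 1 + Δ ∈ orthogonalGroup (Fin N) ℝ)
    (hdiag : Q = (1 + Δ) * diagonal lam * (1 + Δ)ᵀ) : 0 ≤ condNumber Q := by
  have hpos := eigenvalue_pos hQ hV hdiag
  rw [condNumber, spectrum_eq_range hV hdiag]
  refine div_nonneg (Real.sSup_nonneg ?_) (Real.sInf_nonneg ?_) <;>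
    · rintro _ ⟨i, rfl⟩
      exact (hpos i).le

/-- With `V = 1 + Δ` orthogonal, all eigenvalues in `[0, L]` and `ρ` the spectral radius of `Δ`,
conjugating by `V` changes the diagonal form by at most `L ρ ‖z‖²`. -/
lemma abs_quadForm_sub_le_mul_sum_sq (hV : 1 + Δ ∈ orthogonalGroup (Fin N) ℝ)
    (hdiag : Q = (1 + Δ) * diagonal lam * (1 + Δ)ᵀ) {L : ℝ} (h0 : ∀ i, 0 ≤ lam i)
    (hL : ∀ i, lam i ≤ L) (hL0 : 0 ≤ L) (z : Fin N → ℝ) :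
    |z ⬝ᵥ Q *ᵥ z - ∑ i, lam i * z i ^ 2| ≤ L * specRadius Δ * ∑ i, z i ^ 2 := by
  set ρ := specRadius Δ
  have hρ : 0 ≤ ρ := specRadius_nonneg Δ
  rw [quadForm_eq_sum hdiag]
  set w := (1 + Δ)ᵀ *ᵥ z with hw
  set n := ∑ i, z i ^ 2 with hn
  have hn0 : 0 ≤ n := Finset.sum_nonneg fun i _ => sq_nonneg _
  have hnorm : ∑ i, w i ^ 2 = n := sum_transpose_mulVec_sq_eq hV z
  have hwz : ∀ i, w i - z i = (Δᵀ *ᵥ z) i := fun i => by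
    rw [hw, transpose_add, transpose_one, add_mulVec, one_mulVec, Pi.add_apply]
    ring
  have hminus : ∑ i, |w i - z i| ^ 2 ≤ ρ ^ 2 * n := by
    simp only [sq_abs, hwz]
    exact sum_transpose_mulVec_sq_le (mul_transpose_comm_of_one_add_mem hV) z
  have hplus : ∑ i, |w i + z i| ^ 2 ≤ 4 * n :=
    calc ∑ i, |w i + z i| ^ 2 ≤ ∑ i, (2 * w i ^ 2 + 2 * z i ^ 2) :=
          Finset.sum_le_sum fun i _ => by rw [sq_abs]; nlinarith [sq_nonneg (w i - z i)]
      _ = 4 * n := by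
          rw [Finset.sum_add_distrib, ← Finset.mul_sum, ← Finset.mul_sum, hnorm]
          ring
  have hcs : ∑ i, |w i - z i| * |w i + z i| ≤ 2 * ρ * n := by
    refine abs_le_of_sq_le_sq' ?_ (by positivity) |>.2
    calc (∑ i, |w i - z i| * |w i + z i|) ^ 2
        ≤ (∑ i, |w i - z i| ^ 2) * ∑ i, |w i + z i| ^ 2 := Finset.sum_mul_sq_le_sq_mul_sq _ _ _
      _ ≤ (ρ ^ 2 * n) * (4 * n) :=
          mul_le_mul hminus hplus (Finset.sum_nonneg fun i _ => sq_nonneg _) (by positivity)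
      _ = (2 * ρ * n) ^ 2 := by ring
  -- Since `w` and `z` have equal norms, the eigenvalues may be centred at `L / 2`.
  have hcentre : ∑ i, lam i * w i ^ 2 - ∑ i, lam i * z i ^ 2 =
      ∑ i, (lam i - L / 2) * ((w i - z i) * (w i + z i)) := by
    have h1 : ∑ i, (lam i - L / 2) * ((w i - z i) * (w i + z i)) =
        ∑ i, lam i * w i ^ 2 - ∑ i, lam i * z i ^ 2
          - L / 2 * (∑ i, w i ^ 2 - ∑ i, z i ^ 2) := by
      rw [← Finset.sum_sub_distrib, ← Finset.sum_sub_distrib, Finset.mul_sum,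
        ← Finset.sum_sub_distrib]
      exact Finset.sum_congr rfl fun i _ => by ring
    rw [h1, hnorm, sub_self, mul_zero, sub_zero]
  calc |∑ i, lam i * w i ^ 2 - ∑ i, lam i * z i ^ 2|
      ≤ ∑ i, |(lam i - L / 2) * ((w i - z i) * (w i + z i))| := by
        rw [hcentre]
        exact Finset.abs_sum_le_sum_abs _ _
    _ ≤ ∑ i, L / 2 * (|w i - z i| * |w i + z i|) := by
        refine Finset.sum_le_sum fun i _ => ?_
        rw [abs_mul, abs_mul (w i - z i)]
        refine mul_le_mul_of_nonneg_right ?_ (by positivity)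
        rw [abs_le]
        constructor <;> linarith [h0 i, hL i]
    _ = L / 2 * ∑ i, |w i - z i| * |w i + z i| := by rw [Finset.mul_sum]
    _ ≤ L / 2 * (2 * ρ * n) := mul_le_mul_of_nonneg_left hcs (by linarith)
    _ = L * ρ * n := by ring

/-- The relative perturbation of the diagonal form is at most `κ ρ`. -/
lemma abs_quadForm_sub_le (hQ : Q.PosDef) (hV : 1 + Δ ∈ orthogonalGroup (Fin N) ℝ)
    (hdiag : Q = (1 + Δ) * diagonal lam * (1 + Δ)ᵀ) (z : Fin N → ℝ) :
    |z ⬝ᵥ Q *ᵥ z - ∑ i, lam i * z i ^ 2| ≤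
      condNumber Q * specRadius Δ * ∑ i, lam i * z i ^ 2 := by
  rcases isEmpty_or_nonempty (Fin N) with hN | hN
  · simp
  have hpos := eigenvalue_pos hQ hV hdiag
  have hfin := Set.finite_range lam
  have hmax : ∀ i, lam i ≤ sSup (Set.range lam) := fun i => le_csSup hfin.bddAbove ⟨i, rfl⟩
  have hmin : ∀ i, sInf (Set.range lam) ≤ lam i := fun i => csInf_le hfin.bddBelow ⟨i, rfl⟩
  have hmin0 : 0 < sInf (Set.range lam) := by
    obtain ⟨i, hi⟩ := (Set.range_nonempty lam).csInf_mem hfin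
    rw [← hi]
    exact hpos i
  have hmax0 : 0 ≤ sSup (Set.range lam) := (hpos hN.some).le.trans (hmax _)
  refine (abs_quadForm_sub_le_mul_sum_sq hV hdiag (fun i => (hpos i).le) hmax hmax0 z).trans ?_
  rw [condNumber, spectrum_eq_range hV hdiag]
  set L := sSup (Set.range lam)
  set l := sInf (Set.range lam)
  have hle : l * ∑ i, z i ^ 2 ≤ ∑ i, lam i * z i ^ 2 := by
    rw [Finset.mul_sum]
    exact Finset.sum_le_sum fun i _ => mul_le_mul_of_nonneg_right (hmin i) (sq_nonneg _)
  calc L * specRadius Δ * ∑ i, z i ^ 2 = L / l * specRadius Δ * (l * ∑ i, z i ^ 2) := by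
        field_simp
    _ ≤ _ := mul_le_mul_of_nonneg_left hle
        (mul_nonneg (div_nonneg hmax0 hmin0.le) (specRadius_nonneg Δ))

lemma quadForm_le_upperFactor_mul (hQ : Q.PosDef) (hV : 1 + Δ ∈ orthogonalGroup (Fin N) ℝ)
    (hdiag : Q = (1 + Δ) * diagonal lam * (1 + Δ)ᵀ) (z : Fin N → ℝ) :
    z ⬝ᵥ Q *ᵥ z ≤ upperFactor Q Δ * ∑ i, lam i * z i ^ 2 := by
  have h1 := (abs_le.mp (abs_quadForm_sub_le hQ hV hdiag z)).2
  have h2 : 0 ≤ ∑ i, lam i * z i ^ 2 := Finset.sum_nonneg fun i _ =>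
    mul_nonneg (eigenvalue_pos hQ hV hdiag i).le (sq_nonneg _)
  have h3 : 0 ≤ condNumber Q * specRadius Δ ^ 2 * ∑ i, lam i * z i ^ 2 :=
    mul_nonneg (mul_nonneg (condNumber_nonneg hQ hV hdiag) (sq_nonneg _)) h2
  rw [upperFactor]
  linarith

/-- `(1 - κρ) Λ` is an admissible diagonal matrix in the relaxation. -/
lemma posSemidef_sub_lowerFactor (hQ : Q.PosDef) (hV : 1 + Δ ∈ orthogonalGroup (Fin N) ℝ)
    (hdiag : Q = (1 + Δ) * diagonal lam * (1 + Δ)ᵀ) :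
    (Q - diagonal fun i => lowerFactor Q Δ * lam i).PosSemidef := by
  refine .of_dotProduct_mulVec_nonneg (hQ.isHermitian.sub (isHermitian_diagonal _)) fun z => ?_
  have h1 := (abs_le.mp (abs_quadForm_sub_le hQ hV hdiag z)).1
  have h2 : ∑ i, lowerFactor Q Δ * lam i * z i ^ 2 =
      (1 - condNumber Q * specRadius Δ) * ∑ i, lam i * z i ^ 2 := by
    rw [Finset.mul_sum]
    exact Finset.sum_congr rfl fun i _ => by rw [lowerFactor]; ring
  rw [star_trivial, sub_mulVec, dotProduct_sub, dotProduct_diagonal_mulVec, h2]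
  linarith

lemma lowerFactor_le_upperFactor (hκ : 0 ≤ condNumber Q) :
    lowerFactor Q Δ ≤ upperFactor Q Δ := by
  have h1 := mul_nonneg hκ (specRadius_nonneg Δ)
  have h2 := mul_nonneg hκ (sq_nonneg (specRadius Δ))
  rw [lowerFactor, upperFactor]
  linarith

end QuadForm

end CardMin

theorem theorem4 {N : ℕ} (Q Δ : Matrix (Fin N) (Fin N) ℝ) (lam c : Fin N → ℝ) (γ : ℝ)
    (hQ : Q.PosDef) (hγ : 0 < γ)
    (hV : 1 + Δ ∈ Matrix.orthogonalGroup (Fin N) ℝ)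
    (hdiag : Q = (1 + Δ) * Matrix.diagonal lam * (1 + Δ).transpose)
    (hsmall : CardMin.condNumber Q * CardMin.specRadius Δ < 1) :
    (CardMin.lowerNA Q Δ lam c γ ≤ CardMin.maxZeros Q c γ ∧
      CardMin.maxZeros Q c γ ≤ CardMin.diagRelaxMaxZeros Q c γ ∧
      CardMin.diagRelaxMaxZeros Q c γ ≤ CardMin.upperNA Q Δ lam c γ) ∧
    ((CardMin.upperNA Q Δ lam c γ : ℝ) ≤
      (⌈((CardMin.lowerNA Q Δ lam c γ : ℝ) + 1) * CardMin.ratioNA Q Δ⌉ : ℝ) - 1) ∧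
    (0 < CardMin.lowerNA Q Δ lam c γ →
      (CardMin.diagRelaxMaxZeros Q c γ : ℝ) / (CardMin.maxZeros Q c γ : ℝ) ≤
        (CardMin.upperNA Q Δ lam c γ : ℝ) / (CardMin.lowerNA Q Δ lam c γ : ℝ) ∧
      (CardMin.upperNA Q Δ lam c γ : ℝ) / (CardMin.lowerNA Q Δ lam c γ : ℝ) ≤
        ((⌈((CardMin.lowerNA Q Δ lam c γ : ℝ) + 1) * CardMin.ratioNA Q Δ⌉ : ℝ) - 1) /
          (CardMin.lowerNA Q Δ lam c γ : ℝ)) := by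
  have hlower := CardMin.maxCount_le_maxZeros
    (CardMin.quadForm_le_upperFactor_mul hQ hV hdiag) c hγ.le
  have hrelax := CardMin.maxZeros_le_diagRelaxMaxZeros hQ.posSemidef c hγ.le
  have hpos := CardMin.eigenvalue_pos hQ hV hdiag
  have hf : 0 < CardMin.lowerFactor Q Δ := sub_pos.mpr hsmall
  have hupper := (CardMin.diagRelaxMaxZeros_le
    (Matrix.posSemidef_diagonal_iff.mpr fun i => mul_nonneg hf.le (hpos i).le)
    (CardMin.posSemidef_sub_lowerFactor hQ hV hdiag) c γ).trans
    (CardMin.maxZeros_diagonal_le hf.le (fun i => (hpos i).le) c hγ.le)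
  have hlt := CardMin.maxCount_lt_mul_div hf (CardMin.lowerFactor_le_upperFactor (Δ := Δ)
    (CardMin.condNumber_nonneg hQ hV hdiag)) (fun n => lam n * c n ^ 2) hγ.le
  have hceil : (CardMin.upperNA Q Δ lam c γ : ℝ) ≤
      (⌈((CardMin.lowerNA Q Δ lam c γ : ℝ) + 1) * CardMin.ratioNA Q Δ⌉ : ℝ) - 1 := by
    have hint : ((CardMin.upperNA Q Δ lam c γ : ℕ) : ℤ) <
        ⌈((CardMin.lowerNA Q Δ lam c γ : ℝ) + 1) * CardMin.ratioNA Q Δ⌉ :=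
      Int.lt_ceil.mpr (by exact_mod_cast hlt)
    have hreal : (((CardMin.upperNA Q Δ lam c γ : ℕ) : ℤ) : ℝ) ≤
        ((⌈((CardMin.lowerNA Q Δ lam c γ : ℝ) + 1) * CardMin.ratioNA Q Δ⌉ - 1 : ℤ) : ℝ) :=
      Int.cast_le.mpr (Int.le_sub_one_of_lt hint)
    push_cast at hreal
    exact hreal
  refine ⟨⟨hlower, hrelax, hupper⟩, hceil, fun h0 => ⟨?_, ?_⟩⟩
  · exact div_le_div₀ (Nat.cast_nonneg _) (Nat.cast_le.mpr hupper) (Nat.cast_pos.mpr h0)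
      (Nat.cast_le.mpr hlower)
  · exact div_le_div_of_nonneg_right hceil (Nat.cast_nonneg _)
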